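/- Consider $N$ queues with infinite buffers and $K$ servers in slotted time $t=1,2,\dots$. The connectivities $C_{n,k}(t)\in\{0,1\}$ are i.i.d. Bernoulli($p$), the arrivals $A_n(t)\in\{0,1\}$ are i.i.d. Bernoulli($\lambda$), all of these are mutually independent, and they are independent of the initial queue lengths $X(0)\in\mathbb{Z}_+^N$, whose distribution is arbitrary. A server assignment policy $\pi$ chooses in every slot $t$ a matching $M^{\pi}(t)$ of the complete bipartite graph on queues and servers, i.e. a matrix with entries $M^{\pi}_{n,k}(t)\in\{0,1\}$, $\sum_k M^{\pi}_{n,k}(t)\le 1$ for every $n$ and $\sum_n M^{\pi}_{n,k}(t)\le1$ for every $k$. The choice is causal: it depends on $X(0)$, the connectivities up to slot $t$, the arrivals before slot $t$ and, possibly, on private randomization independent of $X(0)$ and of all connectivities and arrivals. The queue lengths evolve by $$X^{\pi}_n(t)=\Big(X^{\pi}_n(t-1)-\sum_{k=1}^K C_{n,k}(t)M^{\pi}_{n,k}(t)\Big)^+ +A_n(t),\qquad X^{\pi}(0)=X(0).$$ A policy is a Maximum Weighted Matching (MWM) policy if in every slot $t$ its matching (almost surely) maximizes $\sum_n X_n(t-1)\sum_k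 M_{n,k}C_{n,k}(t)$ over all matchings $M$. For $\tilde x,x\in\mathbb{Z}_+^N$ write $\tilde x\preceq x$ if (D1) $\tilde x_n\le x_n$ for all $n$; or (D2) $\tilde x$ is obtained from $x$ by exchanging two entries; or (D3) $\tilde x$ and $x$ differ in exactly two entries $n,m$, with $\tilde x_n=x_n+1$, $\tilde x_m=x_m-1$ and $x_n<\tilde x_n\le\tilde x_m<x_m$. Let $\preceq_p$ be the transitive closure of $\preceq$ and let $\mathcal F$ be the set of functions $f:\mathbb{Z}_+^N\to\mathbb{R}$ such that $\tilde x\preceq_p x$ implies $f(\tilde x)\le f(x)$. Theorem. Every MWM policy $\sigma$ dominates every causal server assignment policy $\pi$: for all $f\in\mathcal F$, all $t$ and all $r\in\mathbb{R}$, $$\Pr\big(f(X^{\sigma}(t))>r\big)\le\Pr\big(f(X^{\pi}(t))>r\big).$$ In particular $E\big[\sum_n X^{\sigma}_n(t)\big]\le E\big[\sum_n X^{\pi}_n(t)\big]$ for every $t$, and hence for every horizon $T$ the average delay, that is the expected total number of slots spent in the system by packets during the first $T$ slots, $\sum_{t=0}^{T-1}E\big[\sum_n X_n(t)\big]$, divided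 by the expected number of packets present initially or arriving in these slots, is not larger under $\sigma$ than under $\pi$. -/

import Mathlib

open MeasureTheory ProbabilityTheory
open scoped ENNReal

namespace MQMS

/-! Slots are numbered from `0`.  `C t`, `A t`, `M t` are the connectivities, arrivals and the
employed matching of slot `t`; `X t` is the queue length vector at the beginning of slot `t`
(that is, at the end of the preceding slot), so `X 0` is the initial state. -/

/-! ### Matchings -/

/-- The 0-1 matrix `M` is a matching in the complete bipartite graph on `N` queues and
`K` servers. -/
def IsMatching {N K : ℕ} (M : Fin N → Fin K → ℕ) : Prop :=
  (∀ n k, M n k = 0 ∨ M n k = 1) ∧ (∀ n, ∑ k, M n k ≤ 1) ∧ (∀ k, ∑ n, M n k ≤ 1)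

/-- Weight of the matching `M` for queue lengths `x` and connectivities `c`. -/
def matchingWeight {N K : ℕ} (x : Fin N → ℕ) (c M : Fin N → Fin K → ℕ) : ℕ :=
  ∑ n, x n * ∑ k, c n k * M n k

/-- `M` is a maximum weighted matching for queue lengths `x` and connectivities `c`. -/
def IsMaxWeightMatching {N K : ℕ} (x : Fin N → ℕ) (c M : Fin N → Fin K → ℕ) : Prop :=
  IsMatching M ∧ ∀ M' : Fin N → Fin K → ℕ, IsMatching M' →
    matchingWeight x c M' ≤ matchingWeight x c M

/-! ### The stochastic model -/

section Model

variable {Ω : Type*} {N K : ℕ}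

/-- The random inputs of the system: the connectivities are Bernoulli(`p`), the arrivals are
Bernoulli(`lam`), all of them are mutually independent, and they are independent of the
(arbitrarily distributed) initial queue lengths. -/
structure IsInput [MeasurableSpace Ω] (μ : Measure Ω) (p lam : unitInterval)
    (X₀ : Ω → Fin N → ℕ) (C : ℕ → Ω → Fin N → Fin K → ℕ) (A : ℕ → Ω → Fin N → ℕ) : Prop where
  measurable_init : Measurable X₀
  measurable_conn : ∀ t, Measurable (C t)
  measurable_arr : ∀ t, Measurable (A t)
  conn_law : ∀ t n k, μ.map (fun ω => C t ω n k) = bernoulliMeasure 1 0 p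
  arr_law : ∀ t n, μ.map (fun ω => A t ω n) = bernoulliMeasure 1 0 lam
  indep : iIndepFun
    (fun (i : (ℕ × Fin N × Fin K) ⊕ (ℕ × Fin N)) (ω : Ω) =>
      Sum.elim (fun a => C a.1 ω a.2.1 a.2.2) (fun b => A b.1 ω b.2) i) μ
  indep_init : IndepFun X₀ (fun ω => (fun t => C t ω, fun t => A t ω)) μ

/-- The information available when the matching of slot `t` is chosen: the initial queue
lengths, the connectivities up to and including slot `t`, and the arrivals of earlier slots.
(Past queue lengths and services are determined by these and by the past matchings.) -/
abbrev history (X₀ : Ω → Fin N → ℕ) (C : ℕ → Ω → Fin N → Fin K → ℕ)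
    (A : ℕ → Ω → Fin N → ℕ) (t : ℕ) : MeasurableSpace Ω :=
  MeasurableSpace.comap
    (fun ω => (X₀ ω, fun s : Fin (t + 1) => C s ω, fun s : Fin t => A s ω)) inferInstance

/-- A causal server assignment policy: a random matching in every slot that is a function of the
history and, possibly, of private randomization (`seed`) independent of all inputs of the
system.  Deterministic policies are those with `seed = ⊥`. -/
structure Policy [mΩ : MeasurableSpace Ω] (μ : Measure Ω)
    (X₀ : Ω → Fin N → ℕ) (C : ℕ → Ω → Fin N → Fin K → ℕ) (A : ℕ → Ω → Fin N → ℕ) where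
  M : ℕ → Ω → Fin N → Fin K → ℕ
  isMatching : ∀ t ω, IsMatching (M t ω)
  seed : MeasurableSpace Ω
  seed_le : seed ≤ mΩ
  seed_indep : Indep seed
    (MeasurableSpace.comap (fun ω => (X₀ ω, fun t => C t ω, fun t => A t ω)) inferInstance) μ
  causal : ∀ t, Measurable[seed ⊔ history X₀ C A t] (M t)

/-- Evolution of the queue lengths when the matchings `M` are employed; the subtraction is
truncated at `0`. -/
def queueLength (X₀ : Ω → Fin N → ℕ) (C : ℕ → Ω → Fin N → Fin K → ℕ)
    (A : ℕ → Ω → Fin N → ℕ) (M : ℕ → Ω → Fin N → Fin K → ℕ) : ℕ → Ω → Fin N → ℕ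
  | 0, ω => X₀ ω
  | t + 1, ω => fun n =>
      (queueLength X₀ C A M t ω n - ∑ k, C t ω n k * M t ω n k) + A t ω n

/-- The queue length process under a policy. -/
def Policy.X [MeasurableSpace Ω] {μ : Measure Ω} {X₀ : Ω → Fin N → ℕ}
    {C : ℕ → Ω → Fin N → Fin K → ℕ} {A : ℕ → Ω → Fin N → ℕ} (π : Policy μ X₀ C A) :
    ℕ → Ω → Fin N → ℕ :=
  queueLength X₀ C A π.M

/-- A policy is a Maximum Weighted Matching policy if it (almost surely) employs a maximum
weighted matching in every slot. -/
def Policy.IsMWM [MeasurableSpace Ω] {μ : Measure Ω} {X₀ : Ω → Fin N → ℕ}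
    {C : ℕ → Ω → Fin N → Fin K → ℕ} {A : ℕ → Ω → Fin N → ℕ} (π : Policy μ X₀ C A) : Prop :=
  ∀ t, ∀ᵐ ω ∂μ, IsMaxWeightMatching (π.X t ω) (C t ω) (π.M t ω)

end Model

/-! ### The order on queue length vectors and the cost functions -/

/-- `y` is obtained from `x` by exchanging the entries of two distinct queues. -/
def IsSwap {N : ℕ} (y x : Fin N → ℕ) : Prop :=
  ∃ n m, n ≠ m ∧ y n = x m ∧ y m = x n ∧ ∀ i, i ≠ n → i ≠ m → y i = x i

/-- `y` is obtained from `x` by a balancing interchange: one packet is moved from a larger entry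
`m` to a smaller entry `n`, without reversing their order. -/
def IsBalancingInterchange {N : ℕ} (y x : Fin N → ℕ) : Prop :=
  ∃ n m, x n < y n ∧ y n ≤ y m ∧ y m < x m ∧ y n = x n + 1 ∧ y m + 1 = x m ∧
    ∀ i, i ≠ n → i ≠ m → y i = x i

/-- One elementary step `y ⪯ x`: packet removals, a swap, or a balancing interchange. -/
def Step {N : ℕ} (y x : Fin N → ℕ) : Prop :=
  (∀ n, y n ≤ x n) ∨ IsSwap y x ∨ IsBalancingInterchange y x

/-- The relation `y ⪯ₚ x`, the transitive closure of `⪯`. -/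
def Preceq {N : ℕ} : (Fin N → ℕ) → (Fin N → ℕ) → Prop :=
  Relation.TransGen Step

/-- The class of cost functions: real functions that are non-decreasing for `⪯ₚ`. -/
def IsCost {N : ℕ} (f : (Fin N → ℕ) → ℝ) : Prop :=
  ∀ y x, Preceq y x → f y ≤ f x

/-! ### Stochastic order, domination and delay -/

/-- Stochastic order of real-valued processes. -/
def StochLE {Ω : Type*} [MeasurableSpace Ω] (μ : Measure Ω) (Y Z : ℕ → Ω → ℝ) : Prop :=
  ∀ t, ∀ r : ℝ, μ {ω | r < Y t ω} ≤ μ {ω | r < Z t ω}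

/-- The queue length process `Y` dominates the queue length process `Z`. -/
def Dominates {Ω : Type*} [MeasurableSpace Ω] {N : ℕ} (μ : Measure Ω)
    (Y Z : ℕ → Ω → Fin N → ℕ) : Prop :=
  ∀ f : (Fin N → ℕ) → ℝ, IsCost f →
    StochLE μ (fun t ω => f (Y t ω)) (fun t ω => f (Z t ω))

/-- Expected total queue occupancy at the beginning of slot `t` (possibly infinite, if the
initial occupancy is not integrable). -/
noncomputable def expectedOccupancy {Ω : Type*} [MeasurableSpace Ω] {N : ℕ} (μ : Measure Ω)
    (X : ℕ → Ω → Fin N → ℕ) (t : ℕ) : ℝ≥0∞ :=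
  ∫⁻ ω, ((∑ n, X t ω n : ℕ) : ℝ≥0∞) ∂μ

/-- Average delay over the first `T` slots: the expected total number of slots that packets spend
in the system during this time, divided by the expected number of packets that are present
initially or arrive during this time. -/
noncomputable def averageDelay {Ω : Type*} [MeasurableSpace Ω] {N : ℕ} (μ : Measure Ω)
    (X₀ : Ω → Fin N → ℕ) (A : ℕ → Ω → Fin N → ℕ) (X : ℕ → Ω → Fin N → ℕ) (T : ℕ) : ℝ≥0∞ :=
  (∑ t ∈ Finset.range T, expectedOccupancy μ X t) /
    ∫⁻ ω, ((∑ n, X₀ ω n + ∑ t ∈ Finset.range T, ∑ n, A t ω n : ℕ) : ℝ≥0∞) ∂μ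

end MQMS

/-! The proof is backward induction resting on one deterministic fact, `IsMaxWeightMatching.preceq`:
a maximum weight matching `E` leaves a backlog that is least for `Preceq`. Suppose a matching `E'`
serves a nonempty queue `i` that `E` does not serve. The alternating path from `i` must end at a
queue `b` served by `E` only, since otherwise `E` could gain weight, and optimality of `E` gives `x
i ≤ x b`. Exchanging `E'` along this path serves `b` instead of `i`, an elementary improvement that
brings `E'` closer to `E`.

Hence one and the same matching minimizes every step-monotone cost of the backlog. Averaging over
arrivals and connectivities keeps a cost step-monotone (`StepMono.arrivalCost`,
`StepMono.stepCost`): removals and interchanges survive common inputs, and swaps are absorbed by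
exchangeability of the input laws. As the inputs of a slot are independent of the past, induction on
time gives `lintegral_X_le_of_isMWM` for all such costs at once. Indicators of superlevel sets yield
the stochastic order, and the total queue length yields occupancy and delay. Costs take values in
`ℝ≥0∞`, so integrability never matters. -/

namespace MQMS

/-! ### Stability of the order under permutations, arrivals and services -/

section Deterministic

variable {N K : ℕ}

/-- Monotonicity of an extended nonnegative cost along the elementary steps. -/
def StepMono (h : (Fin N → ℕ) → ℝ≥0∞) : Prop :=
  ∀ y x, Step y x → h y ≤ h x

lemma StepMono.preceq {h : (Fin N → ℕ) → ℝ≥0∞} (hh : StepMono h) {y x : Fin N → ℕ}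
    (hyx : Preceq y x) : h y ≤ h x := by
  induction hyx with
  | single hs => exact hh _ _ hs
  | tail _ hs ih => exact ih.trans (hh _ _ hs)

lemma IsSwap.exists_eq_comp {y x : Fin N → ℕ} (h : IsSwap y x) :
    ∃ τ : Equiv.Perm (Fin N), y = x ∘ τ := by
  obtain ⟨n, m, -, h1, h2, h3⟩ := h
  refine ⟨Equiv.swap n m, funext fun i => ?_⟩
  rcases eq_or_ne i n with rfl | hin
  · simp [h1]
  rcases eq_or_ne i m with rfl | him
  · simp [h2]
  · simp [Equiv.swap_apply_of_ne_of_ne hin him, h3 i hin him]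

lemma StepMono.comp_perm {h : (Fin N → ℕ) → ℝ≥0∞} (hh : StepMono h)
    (τ : Equiv.Perm (Fin N)) (x : Fin N → ℕ) : h (x ∘ τ) ≤ h x := by
  induction τ using Equiv.Perm.swap_induction_on generalizing x with
  | one => exact le_rfl
  | swap_mul f n m hnm ih =>
    refine (ih (x ∘ Equiv.swap n m)).trans (hh _ _ (Or.inr (Or.inl ⟨n, m, hnm, ?_, ?_, ?_⟩)))
    · simp
    · simp
    · intro i hin him
      simp [Equiv.swap_apply_of_ne_of_ne hin him]

/-- Adding the same arrivals preserves a balancing interchange up to a swap. -/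
lemma IsBalancingInterchange.step_add {y x a : Fin N → ℕ} (h : IsBalancingInterchange y x)
    (ha : ∀ n, a n ≤ 1) : Step (fun n => y n + a n) (fun n => x n + a n) := by
  obtain ⟨n, m, h1, h2, h3, h4, h5, h6⟩ := h
  have hn := ha n
  have hm := ha m
  have hnm : n ≠ m := by rintro rfl; omega
  by_cases hc : y n + a n ≤ y m + a m
  · exact Or.inr (Or.inr ⟨n, m, by beta_reduce; omega, hc, by beta_reduce; omega, by beta_reduce; omega, by beta_reduce; omega,
      fun i hi hi' => by beta_reduce; rw [h6 i hi hi']⟩)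
  -- Order is reversed only if `y n = y m` and the arrival is at `n` alone; the interchange then
  -- amounts to a swap.
  · exact Or.inr (Or.inl ⟨n, m, hnm, by beta_reduce; omega, by beta_reduce; omega, fun i hi hi' => by beta_reduce; rw [h6 i hi hi']⟩)

/-- Applying the same services preserves a balancing interchange up to a swap or a removal. -/
lemma IsBalancingInterchange.step_sub {y x s : Fin N → ℕ} (h : IsBalancingInterchange y x)
    (hs : ∀ n, s n ≤ 1) : Step (fun n => y n - s n) (fun n => x n - s n) := by
  obtain ⟨n, m, h1, h2, h3, h4, h5, h6⟩ := h
  have hn := hs n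
  have hm := hs m
  have hnm : n ≠ m := by rintro rfl; omega
  -- Here the service at `n` is wasted in `x` but removes the moved packet in `y`, so only a removal
  -- at `m` can remain.
  by_cases h0 : x n = 0 ∧ s n = 1
  · refine Or.inl fun i => ?_
    rcases eq_or_ne i n with rfl | hin
    · beta_reduce; omega
    rcases eq_or_ne i m with rfl | him
    · beta_reduce; omega
    · beta_reduce; rw [h6 i hin him]
  by_cases hc : y n - s n ≤ y m - s m
  · exact Or.inr (Or.inr ⟨n, m, by beta_reduce; omega, hc, by beta_reduce; omega, by beta_reduce; omega, by beta_reduce; omega,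
      fun i hi hi' => by beta_reduce; rw [h6 i hi hi']⟩)
  · exact Or.inr (Or.inl ⟨n, m, hnm, by beta_reduce; omega, by beta_reduce; omega, fun i hi hi' => by beta_reduce; rw [h6 i hi hi']⟩)

/-! ### Alternating paths and exchanges between two matchings -/

/-- The change of the row sum at `n` when the columns in `S` are replaced in `E` by those
of `E'`. -/
def rowChange (E E' : Fin N → Fin K → ℕ) (S : Finset (Fin K)) (n : Fin N) : ℤ :=
  ∑ k ∈ S, ((E' n k : ℤ) - E n k)

lemma IsMatching.eq_zero_of_col {E : Fin N → Fin K → ℕ} (hE : IsMatching E) {n m : Fin N}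
    {k : Fin K} (h : E n k = 1) (hnm : m ≠ n) : E m k = 0 := by
  have h1 := hE.2.2 k
  have h2 : ∑ i ∈ ({n, m} : Finset (Fin N)), E i k ≤ ∑ i, E i k :=
    Finset.sum_le_sum_of_subset (Finset.subset_univ _)
  rw [Finset.sum_pair hnm.symm] at h2
  omega

lemma IsMatching.eq_zero_of_row {E : Fin N → Fin K → ℕ} (hE : IsMatching E) {n : Fin N}
    {k l : Fin K} (h : E n k = 1) (hkl : l ≠ k) : E n l = 0 := by
  have h1 := hE.2.1 n
  have h2 : ∑ i ∈ ({k, l} : Finset (Fin K)), E n i ≤ ∑ i, E n i :=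
    Finset.sum_le_sum_of_subset (Finset.subset_univ _)
  rw [Finset.sum_pair hkl.symm] at h2
  omega

lemma IsMatching.exists_eq_one {E : Fin N → Fin K → ℕ} (hE : IsMatching E) {n : Fin N}
    (h : ∑ k, E n k ≠ 0) : ∃ k, E n k = 1 := by
  obtain ⟨k, -, hk⟩ := Finset.exists_ne_zero_of_sum_ne_zero h
  exact ⟨k, (hE.1 n k).resolve_left hk⟩

/-- Following the alternating path from a queue `i` served by `E'` but not by `E`: on a suitable
set of servers the two matchings can be exchanged so that the only queues whose service changes
are `i` and possibly one queue `b` which is served by `E` and not by `E'`. -/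
lemma exists_rowChange {E E' : Fin N → Fin K → ℕ} (hE : IsMatching E) (hE' : IsMatching E')
    {i : Fin N} (hi : ∑ k, E i k = 0) (hi' : ∑ k, E' i k = 1) :
    ∃ S : Finset (Fin K), rowChange E E' S i = 1 ∧
      ((∀ n, n ≠ i → rowChange E E' S n = 0) ∨
        ∃ b, b ≠ i ∧ rowChange E E' S b = -1 ∧ ∑ k, E' b k = 0 ∧
          ∀ n, n ≠ i → n ≠ b → rowChange E E' S n = 0) := by
  have hEi : ∀ k, E i k = 0 := fun k => by
    simpa using (Finset.sum_eq_zero_iff.mp hi) k (Finset.mem_univ k)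
  -- one more server is added to a partial path
  have key : ∀ (S : Finset (Fin K)) (k : Fin K) (q : Fin N), k ∉ S → E' q k = 1 →
      E q k = 0 → (∀ n, n ≠ i → n ≠ q → rowChange E E' S n = 0) →
      (q ≠ i → rowChange E E' S q = -1) →
      (∀ n, n ≠ i → rowChange E E' (insert k S) n = 0) ∨
        ∃ b, b ≠ i ∧ rowChange E E' (insert k S) b = -1 ∧
          ∀ n, n ≠ i → n ≠ b → rowChange E E' (insert k S) n = 0 := by
    intro S k q hk hq hqk h0 h1
    have hins : ∀ n, rowChange E E' (insert k S) n
        = ((E' n k : ℤ) - E n k) + rowChange E E' S n := fun n => by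
      simp only [rowChange]
      rw [Finset.sum_insert hk]
    have hcol : ∀ n, n ≠ q → E' n k = 0 := fun n hn => hE'.eq_zero_of_col hq hn
    by_cases hex : ∃ b, E b k = 1
    · obtain ⟨b, hb⟩ := hex
      have hbi : b ≠ i := by rintro rfl; rw [hEi k] at hb; omega
      have hbq : b ≠ q := by rintro rfl; omega
      refine Or.inr ⟨b, hbi, ?_, fun n hn hnb => ?_⟩
      · rw [hins, hcol b hbq, hb, h0 b hbi hbq]; rfl
      · rw [hins, hE.eq_zero_of_col hb hnb]
        rcases eq_or_ne n q with rfl | hnq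
        · rw [hq, h1 hn]; rfl
        · rw [hcol n hnq, h0 n hn hnq]; rfl
    · push Not at hex
      refine Or.inl fun n hn => ?_
      rw [hins, (hE.1 n k).resolve_right (hex n)]
      rcases eq_or_ne n q with rfl | hnq
      · rw [hq, h1 hn]; rfl
      · rw [hcol n hnq, h0 n hn hnq]; rfl
  -- Invariant of the partial path: `i` gains a server and at most one queue `q` loses one. If `E'`
  -- serves `q`, that server lies outside `S` and is added, so the complement of `S` shrinks.
  have extend : ∀ (d : ℕ) (S : Finset (Fin K)), Sᶜ.card = d → rowChange E E' S i = 1 →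
      ((∀ n, n ≠ i → rowChange E E' S n = 0) ∨
        ∃ b, b ≠ i ∧ rowChange E E' S b = -1 ∧
          ∀ n, n ≠ i → n ≠ b → rowChange E E' S n = 0) →
      ∃ S : Finset (Fin K), rowChange E E' S i = 1 ∧
      ((∀ n, n ≠ i → rowChange E E' S n = 0) ∨
        ∃ b, b ≠ i ∧ rowChange E E' S b = -1 ∧ ∑ k, E' b k = 0 ∧
          ∀ n, n ≠ i → n ≠ b → rowChange E E' S n = 0) := by
    intro d
    induction d using Nat.strong_induction_on with
    | _ d ih =>
      rintro S hd hSi (h | ⟨q, hqi, hq, h⟩)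
      · exact ⟨S, hSi, Or.inl h⟩
      by_cases hq0 : ∑ k, E' q k = 0
      · exact ⟨S, hSi, Or.inr ⟨q, hqi, hq, hq0, h⟩⟩
      obtain ⟨k, hk⟩ := hE'.exists_eq_one hq0
      -- some edge of `E` at `q` lies in `S`, and the edge of `E'` does not
      obtain ⟨l, hlS, hl⟩ : ∃ l ∈ S, ((E' q l : ℤ) - E q l) < 0 := by
        by_contra! hcon
        have := Finset.sum_nonneg hcon
        simp only [rowChange] at hq
        omega
      have hl1 : E q l = 1 := (hE.1 q l).resolve_left (by omega)
      -- If `k` were in `S`, its contribution `+1` would offset the `-1` at `l`, while no other term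
      -- in row `q` is negative.
      have hkS : k ∉ S := by
        intro hkS
        have hnn : ∀ j ∈ S.erase l, (0 : ℤ) ≤ (E' q j : ℤ) - E q j := fun j hj => by
          rw [hE.eq_zero_of_row hl1 (Finset.ne_of_mem_erase hj)]
          simp
        have hkl : k ≠ l := by rintro rfl; omega
        have h2 : (E' q k : ℤ) - E q k ≤ ∑ j ∈ S.erase l, ((E' q j : ℤ) - E q j) :=
          Finset.single_le_sum hnn (Finset.mem_erase.mpr ⟨hkl, hkS⟩)
        have h3 := Finset.add_sum_erase S (fun j => (E' q j : ℤ) - E q j) hlS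
        simp only [rowChange] at hq
        rw [hE.eq_zero_of_row hl1 hkl, hk] at h2
        rw [hl1] at h3
        push_cast at h2 h3
        omega
      have hkl : k ≠ l := by rintro rfl; exact hkS hlS
      have hEqk : E q k = 0 := hE.eq_zero_of_row hl1 hkl
      have hSi' : rowChange E E' (insert k S) i = 1 := by
        simp only [rowChange] at hSi ⊢
        rw [Finset.sum_insert hkS, hSi, hEi, hE'.eq_zero_of_col hk hqi.symm]
        rfl
      refine ih _ ?_ (insert k S) rfl hSi' (key S k q hkS hk hEqk h (fun _ => hq))
      rw [← hd]
      refine Finset.card_lt_card ?_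
      rw [Finset.compl_ssubset_compl]
      exact Finset.ssubset_insert hkS
  obtain ⟨k, hk⟩ := hE'.exists_eq_one (n := i) (by omega)
  have hi1 : rowChange E E' (insert k ∅) i = 1 := by simp [rowChange, hEi, hk]
  exact extend _ (insert k ∅) rfl hi1
    (key ∅ k i (by simp) hk (hEi k) (fun n _ _ => by simp [rowChange])
      (fun h => absurd rfl h))

/-- The matching `E` with the columns in `S` replaced by those of `E'`. -/
def mix (E E' : Fin N → Fin K → ℕ) (S : Finset (Fin K)) : Fin N → Fin K → ℕ :=
  fun n k => if k ∈ S then E' n k else E n k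

lemma sum_mix (E E' : Fin N → Fin K → ℕ) (S : Finset (Fin K)) (n : Fin N) :
    ((∑ k, mix E E' S n k : ℕ) : ℤ) = (∑ k, E n k : ℕ) + rowChange E E' S n := by
  have h : rowChange E E' S n = ∑ k, if k ∈ S then ((E' n k : ℤ) - E n k) else 0 := by
    simp [rowChange, Finset.sum_ite_mem]
  rw [h]
  push_cast
  rw [← Finset.sum_add_distrib]
  refine Finset.sum_congr rfl fun k _ => ?_
  simp only [mix]
  split_ifs <;> simp

lemma sum_mix_swap (E E' : Fin N → Fin K → ℕ) (S : Finset (Fin K)) (n : Fin N) :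
    ((∑ k, mix E' E S n k : ℕ) : ℤ) = (∑ k, E' n k : ℕ) - rowChange E E' S n := by
  rw [sum_mix, sub_eq_add_neg]
  congr 1
  simp [rowChange]

/-- Each column comes entirely from one of the two matchings, so only the row sums can fail. -/
lemma IsMatching.mix {E E' : Fin N → Fin K → ℕ} (hE : IsMatching E) (hE' : IsMatching E')
    {S : Finset (Fin K)} (hrow : ∀ n, ((∑ k, E n k : ℕ) : ℤ) + rowChange E E' S n ≤ 1) :
    IsMatching (mix E E' S) := by
  refine ⟨fun n k => ?_, fun n => ?_, fun k => ?_⟩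
  · simp only [MQMS.mix]
    split_ifs
    · exact hE'.1 n k
    · exact hE.1 n k
  · have := hrow n
    rw [← sum_mix] at this
    exact_mod_cast this
  · simp only [MQMS.mix]
    split_ifs
    · exact hE'.2.2 k
    · exact hE.2.2 k

/-! ### Maximum weight matchings leave the least backlog -/

/-- Serving a longer queue `b` instead of a shorter queue `i` is an elementary improvement. -/
lemma step_sub_exchange {x s s' : Fin N → ℕ} {i b : Fin N} (hbi : b ≠ i) (hx : x i ≤ x b)
    (hi : s i = 0) (hb : s b = 1) (hi' : s' i = 1) (hb' : s' b = 0)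
    (h : ∀ n, n ≠ i → n ≠ b → s n = s' n) :
    Step (fun n => x n - s n) (fun n => x n - s' n) := by
  -- Service of an empty `i` is wasted, so serving `b` only removes packets. For nonempty `i`,
  -- unequal lengths give a balancing interchange and equal lengths a swap.
  by_cases h0 : x i = 0
  · refine Or.inl fun n => ?_
    rcases eq_or_ne n i with rfl | hn
    · beta_reduce; omega
    rcases eq_or_ne n b with rfl | hn'
    · beta_reduce; omega
    · beta_reduce; rw [h n hn hn']
  by_cases hlt : x i < x b
  · exact Or.inr (Or.inr ⟨i, b, by beta_reduce; omega, by beta_reduce; omega, by beta_reduce; omega, by beta_reduce; omega, by beta_reduce; omega,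
      fun n hn hn' => by beta_reduce; rw [h n hn hn']⟩)
  · exact Or.inr (Or.inl ⟨i, b, hbi.symm, by beta_reduce; omega, by beta_reduce; omega,
      fun n hn hn' => by beta_reduce; rw [h n hn hn']⟩)

/-- Among the matchings supported by the connectivities, a
maximum weight matching leaves the most balanced backlog. -/
lemma preceq_of_maxWeight {x : Fin N → ℕ} {c E : Fin N → Fin K → ℕ} (hE : IsMatching E)
    (hEc : ∀ n k, E n k ≤ c n k)
    (hmax : ∀ F, IsMatching F → (∀ n k, F n k ≤ c n k) →
      ∑ n, x n * ∑ k, F n k ≤ ∑ n, x n * ∑ k, E n k) :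
    ∀ {E' : Fin N → Fin K → ℕ}, IsMatching E' → (∀ n k, E' n k ≤ c n k) →
      Preceq (fun n => x n - ∑ k, E n k) (fun n => x n - ∑ k, E' n k) := by
  -- The induction measure counts the queues served by `E'` and not by `E`; row sums are at most
  -- one, so truncated subtraction is harmless.
  suffices H : ∀ (d : ℕ) (E' : Fin N → Fin K → ℕ), IsMatching E' → (∀ n k, E' n k ≤ c n k) →
      ∑ n, (∑ k, E' n k) * (1 - ∑ k, E n k) = d →
      Preceq (fun n => x n - ∑ k, E n k) (fun n => x n - ∑ k, E' n k) from
    fun {E'} h1 h2 => H _ E' h1 h2 rfl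
  intro d
  induction d using Nat.strong_induction_on with
  | _ d ih =>
    intro E' hE' hEc' hd
    by_cases hex : ∃ i, 0 < x i ∧ ∑ k, E' i k = 1 ∧ ∑ k, E i k = 0
    swap
    · push Not at hex
      refine Relation.TransGen.single (Or.inl fun n => ?_)
      have h1 := hE.2.1 n
      have h2 := hE'.2.1 n
      have h3 := hex n
      dsimp only
      by_contra hcon
      exact h3 (by omega) (by omega) (by omega)
    obtain ⟨i, hxi, hi', hi⟩ := hex
    obtain ⟨S, hSi, hS⟩ := exists_rowChange hE hE' hi hi'
    have hle : ∀ F F' : Fin N → Fin K → ℕ, (∀ n k, F n k ≤ c n k) → (∀ n k, F' n k ≤ c n k) →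
        ∀ n k, mix F F' S n k ≤ c n k := fun F F' h h' n k => by
      simp only [mix]
      split_ifs
      · exact h' n k
      · exact h n k
    have hweight : IsMatching (mix E E' S) → ∑ n, (x n : ℤ) * rowChange E E' S n ≤ 0 := by
      intro hm
      have h1 := hmax _ hm (hle _ _ hEc hEc')
      zify at h1
      have h2 : ∀ n, ∑ k, ((mix E E' S n k : ℕ) : ℤ)
          = ∑ k, (E n k : ℤ) + rowChange E E' S n := fun n => by
        have := sum_mix E E' S n
        push_cast at this
        exact this
      simp only [h2, mul_add, Finset.sum_add_distrib] at h1
      linarith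
    rcases hS with hS | ⟨b, hbi, hb, hb', hS⟩
    -- A path with no losing queue would augment `E` by the weight `x i > 0`.
    · exfalso
      have hm : IsMatching (mix E E' S) := hE.mix hE' fun n => by
        rcases eq_or_ne n i with rfl | hn
        · rw [hi, hSi]; rfl
        · rw [hS n hn]
          have := hE.2.1 n
          omega
      have h1 := hweight hm
      rw [Finset.sum_eq_single i (fun n _ hn => by rw [hS n hn, mul_zero])
        (fun h => absurd (Finset.mem_univ i) h), hSi] at h1
      omega
    · have hEb : ∑ k, E b k = 1 := by
        have h1 := sum_mix E E' S b
        have h2 := hE.2.1 b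
        omega
      have hm : IsMatching (mix E E' S) := hE.mix hE' fun n => by
        rcases eq_or_ne n i with rfl | hn
        · rw [hi, hSi]; rfl
        rcases eq_or_ne n b with rfl | hnb
        · rw [hb, hEb]; simp
        · rw [hS n hn hnb]
          have := hE.2.1 n
          omega
      have hneg : ∀ n, rowChange E' E S n = - rowChange E E' S n := fun n => by
        simp [rowChange]
      have hm' : IsMatching (mix E' E S) := hE'.mix hE fun n => by
        rw [hneg]
        rcases eq_or_ne n i with rfl | hn
        · rw [hi', hSi]; simp
        rcases eq_or_ne n b with rfl | hnb
        · rw [hb, hb']; simp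
        · rw [hS n hn hnb]
          have := hE'.2.1 n
          omega
      -- The exchange in `E` changes its weight by `x i - x b`, which optimality makes nonpositive.
      have hxb : x i ≤ x b := by
        have h1 := hweight hm
        rw [Finset.sum_eq_add i b hbi.symm
          (fun n _ hn => by rw [hS n hn.1 hn.2, mul_zero])
          (fun h => absurd (Finset.mem_univ i) h)
          (fun h => absurd (Finset.mem_univ b) h), hSi, hb] at h1
        omega
      have hrow : ∀ n, ((∑ k, mix E' E S n k : ℕ) : ℤ)
          = (∑ k, E' n k : ℕ) - rowChange E E' S n := sum_mix_swap E E' S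
      have hri : ∑ k, mix E' E S i k = 0 := by have := hrow i; omega
      have hrb : ∑ k, mix E' E S b k = 1 := by have := hrow b; omega
      have hrn : ∀ n, n ≠ i → n ≠ b → ∑ k, mix E' E S n k = ∑ k, E' n k := fun n hn hnb => by
        have h1 := hrow n
        rw [hS n hn hnb] at h1
        omega
      -- The same `S` is used in the opposite direction to improve `E'`; the new matching no longer
      -- serves `i`, and the queue `b` it gains is served by `E`.
      refine Relation.TransGen.tail
        (ih _ ?_ (mix E' E S) hm' (hle _ _ hEc' hEc) rfl)
        (step_sub_exchange hbi hxb hri hrb hi' hb' hrn)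
      rw [← hd]
      refine Finset.sum_lt_sum (fun n _ => ?_) ⟨i, Finset.mem_univ i, ?_⟩
      · rcases eq_or_ne n i with rfl | hn
        · rw [hri]; simp
        rcases eq_or_ne n b with rfl | hnb
        · rw [hEb]; simp
        · rw [hrn n hn hnb]
      · rw [hri, hi, hi']; simp

lemma IsMatching.conn_mul {c M : Fin N → Fin K → ℕ} (hM : IsMatching M)
    (hc : ∀ n k, c n k = 0 ∨ c n k = 1) : IsMatching (fun n k => c n k * M n k) := by
  have hle : ∀ n k, c n k * M n k ≤ M n k := fun n k => by
    rcases hc n k with h | h <;> simp [h]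
  refine ⟨fun n k => ?_, fun n => (Finset.sum_le_sum fun k _ => hle n k).trans (hM.2.1 n),
    fun k => (Finset.sum_le_sum fun n _ => hle n k).trans (hM.2.2 k)⟩
  rcases hc n k with h | h
  · simp [h]
  · simpa [h] using hM.1 n k

/-- A maximum weighted matching leaves a backlog that precedes the one left by any other
matching. -/
theorem IsMaxWeightMatching.preceq {x : Fin N → ℕ} {c M M' : Fin N → Fin K → ℕ}
    (hM : IsMaxWeightMatching x c M) (hM' : IsMatching M') (hc : ∀ n k, c n k = 0 ∨ c n k = 1) :
    Preceq (fun n => x n - ∑ k, c n k * M n k) (fun n => x n - ∑ k, c n k * M' n k) := by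
  have hle : ∀ F : Fin N → Fin K → ℕ, IsMatching F → ∀ n k, c n k * F n k ≤ c n k :=
    fun F hF n k => by rcases hF.1 n k with h | h <;> simp [h]
  refine preceq_of_maxWeight (c := c) (hM.1.conn_mul hc) (hle M hM.1) (fun F hF hFc => ?_)
    (hM'.conn_mul hc) (hle M' hM')
  have h := hM.2 F hF
  have hcF : ∀ n k, c n k * F n k = F n k := fun n k => by
    have := hFc n k
    rcases hc n k with h | h
    · rw [h] at this ⊢
      omega
    · rw [h, one_mul]
  simpa only [matchingWeight, hcF] using h

lemma IsMatching.comp_perm {M : Fin N → Fin K → ℕ} (hM : IsMatching M)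
    (τ : Equiv.Perm (Fin N)) : IsMatching (M ∘ τ) :=
  ⟨fun n k => hM.1 (τ n) k, fun n => hM.2.1 (τ n), fun k =>
    (Equiv.sum_comp τ fun n => M n k).trans_le (hM.2.2 k)⟩

end Deterministic

/-! ### Step-monotone costs under one step of backward induction -/

section Value

variable {N K : ℕ}

/-- Expected cost after an arrival vector with law `νA` has joined the backlog. -/
noncomputable def arrivalCost (νA : Measure (Fin N → ℕ)) (h : (Fin N → ℕ) → ℝ≥0∞)
    (z : Fin N → ℕ) : ℝ≥0∞ :=
  ∫⁻ a, h (fun n => z n + a n) ∂νA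

/-- Least cost over all matchings when `H` is the cost of the backlog after service. -/
noncomputable def bestCost (H : (Fin N → ℕ) → ℝ≥0∞) (x : Fin N → ℕ)
    (c : Fin N → Fin K → ℕ) : ℝ≥0∞ :=
  ⨅ M : {M : Fin N → Fin K → ℕ // IsMatching M}, H (fun n => x n - ∑ k, c n k * M.1 n k)

/-- One step of backward induction. -/
noncomputable def stepCost (νC : Measure (Fin N → Fin K → ℕ)) (νA : Measure (Fin N → ℕ))
    (h : (Fin N → ℕ) → ℝ≥0∞) (x : Fin N → ℕ) : ℝ≥0∞ :=
  ∫⁻ c, bestCost (arrivalCost νA h) x c ∂νC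

/-- Removals and interchanges are compared under common arrivals. A swap is not, since the arrivals
would have to be swapped too; there the invariance of `νA` is needed. -/
lemma StepMono.arrivalCost {νA : Measure (Fin N → ℕ)} (h01 : ∀ᵐ a ∂νA, ∀ n, a n ≤ 1)
    (hperm : ∀ τ : Equiv.Perm (Fin N), νA.map (fun a => a ∘ τ) = νA)
    {h : (Fin N → ℕ) → ℝ≥0∞} (hh : StepMono h) : StepMono (arrivalCost νA h) := by
  rintro y x (hyx | hyx | hyx)
  · exact lintegral_mono fun a => hh _ _ (Or.inl fun n => Nat.add_le_add_right (hyx n) _)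
  · obtain ⟨τ, rfl⟩ := hyx.exists_eq_comp
    unfold MQMS.arrivalCost
    -- Arrivals are relabelled only in the integral of the permuted state, so that the two
    -- integrands are evaluated at vectors differing by `τ`.
    rw [← hperm τ, lintegral_map .of_discrete .of_discrete, hperm τ]
    exact lintegral_mono fun a => hh.comp_perm τ (fun n => x n + a n)
  · refine lintegral_mono_ae ?_
    filter_upwards [h01] with a ha
    exact hh _ _ (hyx.step_add ha)

lemma bestCost_le {H : (Fin N → ℕ) → ℝ≥0∞} {x : Fin N → ℕ} {c M : Fin N → Fin K → ℕ}
    (hM : IsMatching M) : bestCost H x c ≤ H (fun n => x n - ∑ k, c n k * M n k) :=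
  iInf_le (fun M : {M : Fin N → Fin K → ℕ // IsMatching M} =>
    H (fun n => x n - ∑ k, c n k * M.1 n k)) ⟨M, hM⟩

/-- The minimizing matching does not depend on `H`, which is why a single policy is optimal for
every cost and every horizon. -/
lemma IsMaxWeightMatching.bestCost_eq {H : (Fin N → ℕ) → ℝ≥0∞} (hH : StepMono H)
    {x : Fin N → ℕ} {c M : Fin N → Fin K → ℕ} (hM : IsMaxWeightMatching x c M)
    (hc : ∀ n k, c n k = 0 ∨ c n k = 1) :
    bestCost H x c = H (fun n => x n - ∑ k, c n k * M n k) :=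
  le_antisymm (bestCost_le hM.1) (le_iInf fun M' => hH.preceq (hM.preceq M'.2 hc))

lemma bestCost_comp_perm_le {H : (Fin N → ℕ) → ℝ≥0∞} (hH : StepMono H) (x : Fin N → ℕ)
    (c : Fin N → Fin K → ℕ) (τ : Equiv.Perm (Fin N)) :
    bestCost H (x ∘ τ) (c ∘ τ) ≤ bestCost H x c :=
  le_iInf fun M => (bestCost_le (M.2.comp_perm τ)).trans
    (hH.comp_perm τ (fun n => x n - ∑ k, c n k * M.1 n k))

lemma bestCost_le_of_forall {H : (Fin N → ℕ) → ℝ≥0∞} (hH : StepMono H) {y x : Fin N → ℕ}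
    {c : Fin N → Fin K → ℕ}
    (hstep : ∀ M, IsMatching M → Step (fun n => y n - ∑ k, c n k * M n k)
      (fun n => x n - ∑ k, c n k * M n k)) :
    bestCost H y c ≤ bestCost H x c :=
  le_iInf fun M => (bestCost_le M.2).trans (hH _ _ (hstep M.1 M.2))

/-- Removals and interchanges are compared by giving both states the same connectivities and the
same matching; for swaps, connectivities and matching are permuted along with the queues. -/
lemma StepMono.stepCost {νC : Measure (Fin N → Fin K → ℕ)} {νA : Measure (Fin N → ℕ)}
    (hC01 : ∀ᵐ c ∂νC, ∀ n k, c n k = 0 ∨ c n k = 1)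
    (hCperm : ∀ τ : Equiv.Perm (Fin N), νC.map (fun c => c ∘ τ) = νC)
    (hA01 : ∀ᵐ a ∂νA, ∀ n, a n ≤ 1)
    (hAperm : ∀ τ : Equiv.Perm (Fin N), νA.map (fun a => a ∘ τ) = νA)
    {h : (Fin N → ℕ) → ℝ≥0∞} (hh : StepMono h) : StepMono (stepCost νC νA h) := by
  have hH := hh.arrivalCost hA01 hAperm
  rintro y x (hyx | hyx | hyx)
  · exact lintegral_mono fun c => bestCost_le_of_forall hH fun M _ =>
      Or.inl fun n => Nat.sub_le_sub_right (hyx n) _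
  · obtain ⟨τ, rfl⟩ := hyx.exists_eq_comp
    unfold MQMS.stepCost
    rw [← hCperm τ, lintegral_map .of_discrete .of_discrete, hCperm τ]
    exact lintegral_mono fun c => bestCost_comp_perm_le hH x c τ
  · refine lintegral_mono_ae ?_
    filter_upwards [hC01] with c hc
    exact bestCost_le_of_forall hH fun M hM => hyx.step_sub (hM.conn_mul hc).2.1

end Value

/-! ### Independence of joined sigma-algebras and integration -/

section Independence

variable {Ω : Type*} {m₁ m₂ m₃ : MeasurableSpace Ω} [mΩ : MeasurableSpace Ω] {μ : Measure Ω}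

/-- On the generating π-system of intersections, `μ (a ∩ b ∩ t) = μ a * μ (b ∩ t) = μ a * μ b * μ
t`. -/
lemma indep_sup_left_of_indep_sup [IsProbabilityMeasure μ] (h₁ : m₁ ≤ mΩ) (h₂ : m₂ ≤ mΩ)
    (h₃ : m₃ ≤ mΩ) (h : Indep m₁ (m₂ ⊔ m₃) μ) (h' : Indep m₂ m₃ μ) :
    Indep (m₁ ⊔ m₂) m₃ μ := by
  let p : Set (Set Ω) := {s | ∃ a b, MeasurableSet[m₁] a ∧ MeasurableSet[m₂] b ∧ a ∩ b = s}
  have hpi : IsPiSystem p := by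
    rintro _ ⟨a, b, ha, hb, rfl⟩ _ ⟨a', b', ha', hb', rfl⟩ -
    exact ⟨a ∩ a', b ∩ b', ha.inter ha', hb.inter hb', Set.inter_inter_inter_comm _ _ _ _⟩
  have hgen : m₁ ⊔ m₂ = MeasurableSpace.generateFrom p := by
    apply le_antisymm
    · refine sup_le (fun s hs => MeasurableSpace.measurableSet_generateFrom ?_)
        (fun s hs => MeasurableSpace.measurableSet_generateFrom ?_)
      · exact ⟨s, Set.univ, hs, MeasurableSet.univ, Set.inter_univ s⟩
      · exact ⟨Set.univ, s, MeasurableSet.univ, hs, Set.univ_inter s⟩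
    · refine MeasurableSpace.generateFrom_le ?_
      rintro _ ⟨a, b, ha, hb, rfl⟩
      exact (le_sup_left (b := m₂) a ha).inter (le_sup_right (a := m₁) b hb)
  refine IndepSets.indep (sup_le h₁ h₂) h₃ hpi (@MeasurableSpace.isPiSystem_measurableSet Ω m₃)
    hgen (@MeasurableSpace.generateFrom_measurableSet Ω m₃).symm ?_
  rw [IndepSets_iff]
  rintro _ t ⟨a, b, ha, hb, rfl⟩ ht
  have ht : MeasurableSet[m₃] t := ht
  rw [Indep_iff] at h h'
  rw [Set.inter_assoc, h a (b ∩ t) ha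
    ((le_sup_left (b := m₃) b hb).inter (le_sup_right (a := m₂) t ht)), h' b t hb ht,
    h a b ha (le_sup_left (b := m₃) b hb), mul_assoc]

lemma lintegral_of_indepFun {α β : Type*} [IsProbabilityMeasure μ] [MeasurableSpace α] [MeasurableSpace β]
    {Y : Ω → α} {Z : Ω → β} (hY : Measurable Y) (hZ : Measurable Z) (h : IndepFun Y Z μ)
    {g : α → β → ℝ≥0∞} (hg : Measurable fun q : α × β => g q.1 q.2) :
    ∫⁻ ω, g (Y ω) (Z ω) ∂μ = ∫⁻ ω, ∫⁻ z, g (Y ω) z ∂(μ.map Z) ∂μ := by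
  have := Measure.isProbabilityMeasure_map (μ := μ) hZ.aemeasurable
  rw [← lintegral_map (f := fun q : α × β => g q.1 q.2) hg (hY.prodMk hZ),
    (indepFun_iff_map_prod_eq_prod_map_map hY.aemeasurable hZ.aemeasurable).mp h,
    lintegral_prod _ hg.aemeasurable, lintegral_map hg.lintegral_prod_right' hY]

end Independence

/-! ### Laws and information structure of the inputs -/

section Inputs

variable {Ω : Type*} {N K : ℕ}

/-- Joint law of the connectivities of one slot. -/
noncomputable def connLaw (N K : ℕ) (p : unitInterval) : Measure (Fin N → Fin K → ℕ) :=
  (Measure.pi fun _ : Fin N × Fin K => bernoulliMeasure 1 0 p).map fun c n k => c (n, k)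

/-- Joint law of the arrivals of one slot. -/
noncomputable def arrLaw (N : ℕ) (lam : unitInterval) : Measure (Fin N → ℕ) :=
  Measure.pi fun _ : Fin N => bernoulliMeasure 1 0 lam

/-- The scalar inputs, all connectivities and arrivals, as one family. -/
def input (C : ℕ → Ω → Fin N → Fin K → ℕ) (A : ℕ → Ω → Fin N → ℕ)
    (i : (ℕ × Fin N × Fin K) ⊕ (ℕ × Fin N)) (ω : Ω) : ℕ :=
  Sum.elim (fun a => C a.1 ω a.2.1 a.2.2) (fun b => A b.1 ω b.2) i

/-- The information carried by the inputs with index in `S`. -/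
@[reducible] def inputInfo (C : ℕ → Ω → Fin N → Fin K → ℕ) (A : ℕ → Ω → Fin N → ℕ)
    (S : Set ((ℕ × Fin N × Fin K) ⊕ (ℕ × Fin N))) : MeasurableSpace Ω :=
  ⨆ i ∈ S, MeasurableSpace.comap (input C A i) inferInstance

/-- The indices of the connectivities of slots before `s` and the arrivals of slots before `t`. -/
def before (N K s t : ℕ) : Set ((ℕ × Fin N × Fin K) ⊕ (ℕ × Fin N)) :=
  {i | Sum.elim (fun a => a.1 < s) (fun b => b.1 < t) i}

lemma measurable_input_of_mem (C : ℕ → Ω → Fin N → Fin K → ℕ) (A : ℕ → Ω → Fin N → ℕ)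
    {S : Set ((ℕ × Fin N × Fin K) ⊕ (ℕ × Fin N))} {i} (hi : i ∈ S) :
    Measurable[inputInfo C A S] (input C A i) :=
  Measurable.mono (comap_measurable _)
    (le_iSup₂_of_le (f := fun i (_ : i ∈ S) => MeasurableSpace.comap (input C A i) inferInstance)
      i hi le_rfl) le_rfl

lemma measurable_conn_inputInfo (C : ℕ → Ω → Fin N → Fin K → ℕ) (A : ℕ → Ω → Fin N → ℕ)
    {S : Set ((ℕ × Fin N × Fin K) ⊕ (ℕ × Fin N))} {t : ℕ}
    (h : ∀ n k, Sum.inl (t, n, k) ∈ S) : Measurable[inputInfo C A S] (C t) :=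
  @measurable_pi_lambda _ _ _ (_) _ _ fun n => @measurable_pi_lambda _ _ _ (_) _ _ fun k =>
    measurable_input_of_mem C A (h n k)

lemma measurable_arr_inputInfo (C : ℕ → Ω → Fin N → Fin K → ℕ) (A : ℕ → Ω → Fin N → ℕ)
    {S : Set ((ℕ × Fin N × Fin K) ⊕ (ℕ × Fin N))} {t : ℕ}
    (h : ∀ n, Sum.inr (t, n) ∈ S) : Measurable[inputInfo C A S] (A t) :=
  @measurable_pi_lambda _ _ _ (_) _ _ fun n => measurable_input_of_mem C A (h n)

lemma inputInfo_mono (C : ℕ → Ω → Fin N → Fin K → ℕ) (A : ℕ → Ω → Fin N → ℕ)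
    {S T : Set ((ℕ × Fin N × Fin K) ⊕ (ℕ × Fin N))} (h : S ⊆ T) :
    inputInfo C A S ≤ inputInfo C A T :=
  biSup_mono h

lemma history_le (X₀ : Ω → Fin N → ℕ) (C : ℕ → Ω → Fin N → Fin K → ℕ)
    (A : ℕ → Ω → Fin N → ℕ) (t : ℕ) :
    history X₀ C A t ≤
      MeasurableSpace.comap X₀ inferInstance ⊔ inputInfo C A (before N K (t + 1) t) := by
  rw [history, ← measurable_iff_comap_le]
  refine @Measurable.prodMk _ _ _ _ _ (_) _ _
    ((comap_measurable X₀).mono le_sup_left le_rfl) ?_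
  refine Measurable.mono (ma := inputInfo C A (before N K (t + 1) t)) ?_ le_sup_right le_rfl
  refine @Measurable.prodMk _ _ _ _ _ (_) _ _ ?_ ?_
  · exact @measurable_pi_lambda _ _ _ (_) _ _ fun s =>
      measurable_conn_inputInfo C A fun n k => s.2
  · exact @measurable_pi_lambda _ _ _ (_) _ _ fun s =>
      measurable_arr_inputInfo C A fun n => s.2

lemma inputInfo_le_comap (C : ℕ → Ω → Fin N → Fin K → ℕ) (A : ℕ → Ω → Fin N → ℕ)
    (S : Set ((ℕ × Fin N × Fin K) ⊕ (ℕ × Fin N))) :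
    inputInfo C A S ≤
      MeasurableSpace.comap (fun ω => (fun t => C t ω, fun t => A t ω)) inferInstance := by
  refine iSup₂_le fun i _ => ?_
  rw [← measurable_iff_comap_le]
  have hC : ∀ i : (ℕ × Fin N × Fin K) ⊕ (ℕ × Fin N), Measurable
      fun q : (ℕ → Fin N → Fin K → ℕ) × (ℕ → Fin N → ℕ) =>
        Sum.elim (fun a => q.1 a.1 a.2.1 a.2.2) (fun b => q.2 b.1 b.2) i := by
    rintro (⟨t, n, k⟩ | ⟨t, n⟩)
    · exact (measurable_pi_apply k).comp ((measurable_pi_apply n).comp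
        ((measurable_pi_apply t).comp measurable_fst))
    · exact (measurable_pi_apply n).comp ((measurable_pi_apply t).comp measurable_snd)
  exact (hC i).comp (comap_measurable fun ω => (fun t => C t ω, fun t => A t ω))

variable [mΩ : MeasurableSpace Ω] {μ : Measure Ω} {p lam : unitInterval}
  {X₀ : Ω → Fin N → ℕ} {C : ℕ → Ω → Fin N → Fin K → ℕ} {A : ℕ → Ω → Fin N → ℕ}

lemma ae_bernoulliMeasure (q : unitInterval) :
    ∀ᵐ x ∂(bernoulliMeasure (1 : ℕ) 0 q), x = 0 ∨ x = 1 := by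
  rw [ae_iff]
  exact bernoulliMeasure_apply_of_notMem_of_notMem q .of_discrete (by simp) (by simp)

namespace IsInput

lemma measurable_input (hsys : IsInput μ p lam X₀ C A) (i : (ℕ × Fin N × Fin K) ⊕ (ℕ × Fin N)) : Measurable (input C A i) := by
  rcases i with ⟨t, n, k⟩ | ⟨t, n⟩
  · exact (measurable_pi_apply k).comp ((measurable_pi_apply n).comp (hsys.measurable_conn t))
  · exact (measurable_pi_apply n).comp (hsys.measurable_arr t)

lemma ae_conn (hsys : IsInput μ p lam X₀ C A) (t : ℕ) : ∀ᵐ ω ∂μ, ∀ n k, C t ω n k = 0 ∨ C t ω n k = 1 := by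
  simp only [ae_all_iff]
  intro n k
  have h := ae_bernoulliMeasure p
  rw [← hsys.conn_law t n k] at h
  exact ae_of_ae_map (hsys.measurable_input (Sum.inl (t, n, k))).aemeasurable h

lemma ae_arr (hsys : IsInput μ p lam X₀ C A) (t : ℕ) : ∀ᵐ ω ∂μ, ∀ n, A t ω n ≤ 1 := by
  simp only [ae_all_iff]
  intro n
  have h := ae_bernoulliMeasure lam
  rw [← hsys.arr_law t n] at h
  filter_upwards [ae_of_ae_map (hsys.measurable_input (Sum.inr (t, n))).aemeasurable h]
    with ω hω
  change A t ω n = 0 ∨ A t ω n = 1 at hω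
  omega

/-- Reindexing an independent, identically distributed family along an injection leaves its joint
law unchanged. The case `τ = 1` is the law itself; general `τ` gives exchangeability. -/
lemma map_conn_perm (hsys : IsInput μ p lam X₀ C A) (t : ℕ) (τ : Equiv.Perm (Fin N)) :
    μ.map (fun ω => C t ω ∘ τ) = connLaw N K p := by
  have hinj : Function.Injective fun a : Fin N × Fin K =>
      (Sum.inl (t, τ a.1, a.2) : (ℕ × Fin N × Fin K) ⊕ (ℕ × Fin N)) := by
    rintro ⟨n, k⟩ ⟨n', k'⟩ h
    simpa using h
  have h := (hsys.indep.precomp hinj).map_fun_eq_pi_map fun a : Fin N × Fin K =>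
    (hsys.measurable_input (Sum.inl (t, τ a.1, a.2))).aemeasurable
  have hm : Measurable fun ω (a : Fin N × Fin K) => C t ω (τ a.1) a.2 :=
    measurable_pi_lambda _ fun a => hsys.measurable_input (Sum.inl (t, τ a.1, a.2))
  have h' : μ.map (fun ω (a : Fin N × Fin K) => C t ω (τ a.1) a.2)
      = Measure.pi fun _ => bernoulliMeasure 1 0 p := by
    refine h.trans ?_
    congr 1
    exact funext fun a => hsys.conn_law t (τ a.1) a.2
  rw [connLaw, ← h', Measure.map_map .of_discrete hm]
  rfl

lemma map_arr_perm (hsys : IsInput μ p lam X₀ C A) (t : ℕ) (τ : Equiv.Perm (Fin N)) :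
    μ.map (fun ω => A t ω ∘ τ) = arrLaw N lam := by
  have hinj : Function.Injective fun n : Fin N =>
      (Sum.inr (t, τ n) : (ℕ × Fin N × Fin K) ⊕ (ℕ × Fin N)) := by
    intro n n' h
    simpa using h
  have h := (hsys.indep.precomp hinj).map_fun_eq_pi_map fun n =>
    (hsys.measurable_input (Sum.inr (t, τ n))).aemeasurable
  refine h.trans ?_
  rw [arrLaw]
  congr 1
  exact funext fun n => hsys.arr_law t (τ n)

lemma map_conn (hsys : IsInput μ p lam X₀ C A) (t : ℕ) : μ.map (C t) = connLaw N K p := hsys.map_conn_perm t 1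

lemma map_arr (hsys : IsInput μ p lam X₀ C A) (t : ℕ) : μ.map (A t) = arrLaw N lam := hsys.map_arr_perm t 1

lemma connLaw_perm (hsys : IsInput μ p lam X₀ C A) (τ : Equiv.Perm (Fin N)) :
    (connLaw N K p).map (fun c => c ∘ τ) = connLaw N K p := by
  conv_lhs => rw [← hsys.map_conn 0]
  rw [Measure.map_map .of_discrete (hsys.measurable_conn 0)]
  exact hsys.map_conn_perm 0 τ

lemma arrLaw_perm (hsys : IsInput μ p lam X₀ C A) (τ : Equiv.Perm (Fin N)) :
    (arrLaw N lam).map (fun a => a ∘ τ) = arrLaw N lam := by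
  conv_lhs => rw [← hsys.map_arr 0]
  rw [Measure.map_map .of_discrete (hsys.measurable_arr 0)]
  exact hsys.map_arr_perm 0 τ

lemma ae_connLaw (hsys : IsInput μ p lam X₀ C A) : ∀ᵐ c ∂(connLaw N K p), ∀ n k, c n k = 0 ∨ c n k = 1 := by
  rw [← hsys.map_conn 0, ae_map_iff (hsys.measurable_conn 0).aemeasurable .of_discrete]
  exact hsys.ae_conn 0

lemma ae_arrLaw (hsys : IsInput μ p lam X₀ C A) : ∀ᵐ a ∂(arrLaw N lam), ∀ n, a n ≤ 1 := by
  rw [← hsys.map_arr 0, ae_map_iff (hsys.measurable_arr 0).aemeasurable .of_discrete]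
  exact hsys.ae_arr 0

lemma inputInfo_le (hsys : IsInput μ p lam X₀ C A) (S : Set ((ℕ × Fin N × Fin K) ⊕ (ℕ × Fin N))) : inputInfo C A S ≤ mΩ :=
  iSup₂_le fun i _ => (hsys.measurable_input i).comap_le

/-- Three layers are joined: disjoint sets of inputs are independent, the initial state is
independent of all inputs, and the seed is independent of both. -/
lemma indep_inputInfo (hsys : IsInput μ p lam X₀ C A) [IsProbabilityMeasure μ] (π : Policy μ X₀ C A)
    {S T : Set ((ℕ × Fin N × Fin K) ⊕ (ℕ × Fin N))} (hST : Disjoint S T) :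
    Indep (π.seed ⊔ (MeasurableSpace.comap X₀ inferInstance ⊔ inputInfo C A S))
      (inputInfo C A T) μ := by
  have hX := hsys.measurable_init.comap_le
  have hCA : ∀ S' : Set ((ℕ × Fin N × Fin K) ⊕ (ℕ × Fin N)), inputInfo C A S' ≤
      MeasurableSpace.comap (fun ω => (X₀ ω, fun t => C t ω, fun t => A t ω)) inferInstance := by
    intro S'
    refine (inputInfo_le_comap C A S').trans ?_
    rw [← measurable_iff_comap_le]
    exact measurable_snd.comp
      (comap_measurable (fun ω => (X₀ ω, fun t => C t ω, fun t => A t ω)))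
  have hX₀ : MeasurableSpace.comap X₀ inferInstance ≤
      MeasurableSpace.comap (fun ω => (X₀ ω, fun t => C t ω, fun t => A t ω)) inferInstance := by
    rw [← measurable_iff_comap_le]
    exact measurable_fst.comp
      (comap_measurable (fun ω => (X₀ ω, fun t => C t ω, fun t => A t ω)))
  have h1 : Indep (inputInfo C A S) (inputInfo C A T) μ :=
    indep_iSup_of_disjoint (fun i => (hsys.measurable_input i).comap_le) hsys.indep hST
  have h2 : Indep (MeasurableSpace.comap X₀ inferInstance ⊔ inputInfo C A S)
      (inputInfo C A T) μ :=
    indep_sup_left_of_indep_sup hX (hsys.inputInfo_le S) (hsys.inputInfo_le T)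
      (indep_of_indep_of_le_right hsys.indep_init
        (sup_le (inputInfo_le_comap C A S) (inputInfo_le_comap C A T))) h1
  exact indep_sup_left_of_indep_sup π.seed_le (sup_le hX (hsys.inputInfo_le S))
    (hsys.inputInfo_le T)
    (indep_of_indep_of_le_right π.seed_indep (sup_le (sup_le hX₀ (hCA S)) (hCA T))) h2

end IsInput

end Inputs

/-! ### Measurability along a policy, the induction and its consequences -/

section Domination

variable {Ω : Type*} {N K : ℕ} [mΩ : MeasurableSpace Ω] {μ : Measure Ω} {p lam : unitInterval}
  {X₀ : Ω → Fin N → ℕ} {C : ℕ → Ω → Fin N → Fin K → ℕ} {A : ℕ → Ω → Fin N → ℕ}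

/-- What a policy may know: its seed, the initial state, the connectivities of slots before `s`
and the arrivals of slots before `t`. -/
@[reducible] def Policy.info (π : Policy μ X₀ C A) (s t : ℕ) : MeasurableSpace Ω :=
  π.seed ⊔ (MeasurableSpace.comap X₀ inferInstance ⊔ inputInfo C A (before N K s t))

namespace Policy

lemma info_mono (π : Policy μ X₀ C A) {s s' t t' : ℕ} (hs : s ≤ s') (ht : t ≤ t') :
    π.info s t ≤ π.info s' t' := by
  refine sup_le_sup_left (sup_le_sup_left (inputInfo_mono C A ?_) _) _
  rintro (a | b) h
  · exact lt_of_lt_of_le h hs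
  · exact lt_of_lt_of_le h ht

lemma inputInfo_le_info (π : Policy μ X₀ C A) (s t : ℕ) :
    inputInfo C A (before N K s t) ≤ π.info s t :=
  le_sup_right.trans le_sup_right

lemma measurable_conn_info (π : Policy μ X₀ C A) (s t : ℕ) :
    Measurable[π.info (s + 1) t] (C s) :=
  (measurable_conn_inputInfo C A fun _ _ => Nat.lt_succ_self s).mono
    (π.inputInfo_le_info _ _) le_rfl

lemma measurable_arr_info (π : Policy μ X₀ C A) (s t : ℕ) :
    Measurable[π.info s (t + 1)] (A t) :=
  (measurable_arr_inputInfo C A fun _ => Nat.lt_succ_self t).mono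
    (π.inputInfo_le_info _ _) le_rfl

lemma measurable_matching_info (π : Policy μ X₀ C A) (t : ℕ) :
    Measurable[π.info (t + 1) t] (π.M t) :=
  (π.causal t).mono (sup_le_sup_left (history_le X₀ C A t) _) le_rfl

/-- The backlog left after the service of slot `t`. -/
def backlog (π : Policy μ X₀ C A) (t : ℕ) (ω : Ω) : Fin N → ℕ :=
  fun n => π.X t ω n - ∑ k, C t ω n k * π.M t ω n k

lemma X_succ (π : Policy μ X₀ C A) (t : ℕ) (ω : Ω) :
    π.X (t + 1) ω = fun n => π.backlog t ω n + A t ω n := rfl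

lemma measurable_backlog_info_of_X (π : Policy μ X₀ C A) (t : ℕ)
    (h : Measurable[π.info t t] (π.X t)) : Measurable[π.info (t + 1) t] (π.backlog t) := by
  have h1 : Measurable[π.info (t + 1) t] (π.X t) :=
    h.mono (π.info_mono (Nat.le_succ t) le_rfl) le_rfl
  have h2 : Measurable fun q : (Fin N → ℕ) × (Fin N → Fin K → ℕ) × (Fin N → Fin K → ℕ) =>
      fun n => q.1 n - ∑ k, q.2.1 n k * q.2.2 n k := .of_discrete
  exact h2.comp (@Measurable.prodMk _ _ _ _ _ (_) _ _ h1
    (@Measurable.prodMk _ _ _ _ _ (_) _ _ (π.measurable_conn_info t t)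
      (π.measurable_matching_info t)))

lemma measurable_X_info (π : Policy μ X₀ C A) (t : ℕ) : Measurable[π.info t t] (π.X t) := by
  induction t with
  | zero => exact (comap_measurable X₀).mono (le_sup_left.trans le_sup_right) le_rfl
  | succ t ih =>
    have h1 : Measurable[π.info (t + 1) (t + 1)] (π.backlog t) :=
      (π.measurable_backlog_info_of_X t ih).mono (π.info_mono le_rfl (Nat.le_succ t)) le_rfl
    have h2 : Measurable fun q : (Fin N → ℕ) × (Fin N → ℕ) => fun n => q.1 n + q.2 n :=
      .of_discrete
    exact h2.comp (@Measurable.prodMk _ _ _ _ _ (_) _ _ h1 (π.measurable_arr_info (t + 1) t))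

lemma measurable_backlog_info (π : Policy μ X₀ C A) (t : ℕ) :
    Measurable[π.info (t + 1) t] (π.backlog t) :=
  π.measurable_backlog_info_of_X t (π.measurable_X_info t)

lemma info_le (π : Policy μ X₀ C A) (hsys : IsInput μ p lam X₀ C A) (s t : ℕ) :
    π.info s t ≤ mΩ :=
  sup_le π.seed_le (sup_le hsys.measurable_init.comap_le (hsys.inputInfo_le _))

lemma measurable_X (π : Policy μ X₀ C A) (hsys : IsInput μ p lam X₀ C A) (t : ℕ) :
    Measurable (π.X t) :=
  (π.measurable_X_info t).mono (π.info_le hsys t t) le_rfl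

lemma measurable_backlog (π : Policy μ X₀ C A) (hsys : IsInput μ p lam X₀ C A) (t : ℕ) :
    Measurable (π.backlog t) :=
  (π.measurable_backlog_info t).mono (π.info_le hsys (t + 1) t) le_rfl

lemma indepFun_X_conn [IsProbabilityMeasure μ] (π : Policy μ X₀ C A)
    (hsys : IsInput μ p lam X₀ C A) (t : ℕ) : IndepFun (π.X t) (C t) μ := by
  -- The difference set consists exactly of the connectivity indices of slot `t`.
  have hdisj : Disjoint (before N K t t) (before N K (t + 1) 0 \ before N K t t) :=
    Set.disjoint_sdiff_right
  refine indep_of_indep_of_le (hsys.indep_inputInfo π hdisj)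
    (measurable_iff_comap_le.mp (π.measurable_X_info t))
    (measurable_iff_comap_le.mp (measurable_conn_inputInfo C A fun n k => ?_))
  exact ⟨Nat.lt_succ_self t, Nat.lt_irrefl t⟩

lemma indepFun_backlog_arr [IsProbabilityMeasure μ] (π : Policy μ X₀ C A)
    (hsys : IsInput μ p lam X₀ C A) (t : ℕ) : IndepFun (π.backlog t) (A t) μ := by
  -- The difference set consists exactly of the arrival indices of slot `t`; the connectivities of
  -- that slot are already known.
  have hdisj : Disjoint (before N K (t + 1) t) (before N K 0 (t + 1) \ before N K (t + 1) t) :=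
    Set.disjoint_sdiff_right
  refine indep_of_indep_of_le (hsys.indep_inputInfo π hdisj)
    (measurable_iff_comap_le.mp (π.measurable_backlog_info t))
    (measurable_iff_comap_le.mp (measurable_arr_inputInfo C A fun n => ?_))
  exact ⟨Nat.lt_succ_self t, Nat.lt_irrefl t⟩

end Policy

/-- The arrivals of slot `t` are independent of the backlog and can be integrated out. The state
space is countable, so `h` is automatically measurable. -/
lemma lintegral_X_succ [IsProbabilityMeasure μ] (hsys : IsInput μ p lam X₀ C A)
    (π : Policy μ X₀ C A) (h : (Fin N → ℕ) → ℝ≥0∞) (t : ℕ) :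
    ∫⁻ ω, h (π.X (t + 1) ω) ∂μ = ∫⁻ ω, arrivalCost (arrLaw N lam) h (π.backlog t ω) ∂μ := by
  simp only [π.X_succ]
  rw [lintegral_of_indepFun (g := fun z a => h fun n => z n + a n)
    (π.measurable_backlog hsys t) (hsys.measurable_arr t) (π.indepFun_backlog_arr hsys t)
    .of_discrete, hsys.map_arr]
  rfl

lemma lintegral_stepCost [IsProbabilityMeasure μ] (hsys : IsInput μ p lam X₀ C A)
    (π : Policy μ X₀ C A) (h : (Fin N → ℕ) → ℝ≥0∞) (t : ℕ) :
    ∫⁻ ω, stepCost (connLaw N K p) (arrLaw N lam) h (π.X t ω) ∂μ =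
      ∫⁻ ω, bestCost (arrivalCost (arrLaw N lam) h) (π.X t ω) (C t ω) ∂μ := by
  rw [lintegral_of_indepFun (g := bestCost (arrivalCost (arrLaw N lam) h))
    (π.measurable_X hsys t) (hsys.measurable_conn t) (π.indepFun_X_conn hsys t)
    .of_discrete, hsys.map_conn]
  rfl

/-- A maximum weighted matching policy minimizes the expectation of every nonnegative cost. -/
theorem lintegral_X_le_of_isMWM [IsProbabilityMeasure μ] (hsys : IsInput μ p lam X₀ C A)
    (σ : Policy μ X₀ C A) (hσ : σ.IsMWM) (π : Policy μ X₀ C A) (t : ℕ)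
    {h : (Fin N → ℕ) → ℝ≥0∞} (hh : StepMono h) :
    ∫⁻ ω, h (σ.X t ω) ∂μ ≤ ∫⁻ ω, h (π.X t ω) ∂μ := by
  -- The cost must vary: the induction hypothesis is applied to `stepCost` of `h`.
  induction t generalizing h with
  | zero => exact le_rfl
  | succ t ih =>
    have hH := hh.arrivalCost hsys.ae_arrLaw hsys.arrLaw_perm
    have hV := hh.stepCost hsys.ae_connLaw hsys.connLaw_perm hsys.ae_arrLaw hsys.arrLaw_perm
    calc ∫⁻ ω, h (σ.X (t + 1) ω) ∂μ
        = ∫⁻ ω, arrivalCost (arrLaw N lam) h (σ.backlog t ω) ∂μ := lintegral_X_succ hsys σ h t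
      _ = ∫⁻ ω, bestCost (arrivalCost (arrLaw N lam) h) (σ.X t ω) (C t ω) ∂μ := by
          refine lintegral_congr_ae ?_
          -- Maximality of the weight enters only here, making `σ` attain the infimum; for `π` the
          -- infimum is merely a lower bound.
          filter_upwards [hσ t, hsys.ae_conn t] with ω hω hc
          exact (hω.bestCost_eq hH hc).symm
      _ = ∫⁻ ω, stepCost (connLaw N K p) (arrLaw N lam) h (σ.X t ω) ∂μ :=
          (lintegral_stepCost hsys σ h t).symm
      _ ≤ ∫⁻ ω, stepCost (connLaw N K p) (arrLaw N lam) h (π.X t ω) ∂μ := ih hV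
      _ = ∫⁻ ω, bestCost (arrivalCost (arrLaw N lam) h) (π.X t ω) (C t ω) ∂μ :=
          lintegral_stepCost hsys π h t
      _ ≤ ∫⁻ ω, arrivalCost (arrLaw N lam) h (π.backlog t ω) ∂μ :=
          lintegral_mono fun ω => bestCost_le (π.isMatching t ω)
      _ = ∫⁻ ω, h (π.X (t + 1) ω) ∂μ := (lintegral_X_succ hsys π h t).symm

/-- Tail probabilities are expectations of these indicators, so real costs reduce to nonnegative
ones. -/
lemma stepMono_indicator {f : (Fin N → ℕ) → ℝ} (hf : IsCost f) (r : ℝ) :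
    StepMono ({x | r < f x}.indicator 1) := by
  intro y x hyx
  have hle : f y ≤ f x := hf y x (Relation.TransGen.single hyx)
  by_cases hy : r < f y
  · rw [Set.indicator_of_mem (show y ∈ {x | r < f x} from hy),
      Set.indicator_of_mem (show x ∈ {x | r < f x} from hy.trans_le hle)]
    exact le_rfl
  · rw [Set.indicator_of_notMem (show y ∉ {x | r < f x} from hy)]
    exact zero_le

lemma Step.sum_le {y x : Fin N → ℕ} (h : Step y x) : ∑ n, y n ≤ ∑ n, x n := by
  rcases h with h | h | ⟨n, m, h1, h2, h3, h4, h5, h6⟩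
  · exact Finset.sum_le_sum fun n _ => h n
  · obtain ⟨τ, rfl⟩ := h.exists_eq_comp
    exact (Equiv.sum_comp τ x).le
  · have hnm : n ≠ m := by rintro rfl; omega
    have hm : m ∈ Finset.univ.erase n := Finset.mem_erase.mpr ⟨hnm.symm, Finset.mem_univ m⟩
    rw [← Finset.add_sum_erase _ y (Finset.mem_univ n), ← Finset.add_sum_erase _ y hm,
      ← Finset.add_sum_erase _ x (Finset.mem_univ n), ← Finset.add_sum_erase _ x hm]
    have hrest : ∑ i ∈ (Finset.univ.erase n).erase m, y i
        = ∑ i ∈ (Finset.univ.erase n).erase m, x i := by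
      refine Finset.sum_congr rfl fun i hi => ?_
      rw [Finset.mem_erase, Finset.mem_erase] at hi
      exact h6 i hi.2.1 hi.1
    omega

theorem dominates_of_isMWM [IsProbabilityMeasure μ] (hsys : IsInput μ p lam X₀ C A)
    (σ : Policy μ X₀ C A) (hσ : σ.IsMWM) (π : Policy μ X₀ C A) : Dominates μ σ.X π.X := by
  intro f hf t r
  have hprob : ∀ ρ : Policy μ X₀ C A, ∫⁻ ω, {x | r < f x}.indicator 1 (ρ.X t ω) ∂μ
      = μ {ω | r < f (ρ.X t ω)} := fun ρ => by
    have hS : MeasurableSet {ω | r < f (ρ.X t ω)} :=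
      ρ.measurable_X hsys t (.of_discrete : MeasurableSet {x | r < f x})
    rw [← lintegral_indicator_one hS]
    rfl
  rw [← hprob σ, ← hprob π]
  exact lintegral_X_le_of_isMWM hsys σ hσ π t (stepMono_indicator hf r)

theorem expectedOccupancy_le_of_isMWM [IsProbabilityMeasure μ]
    (hsys : IsInput μ p lam X₀ C A) (σ : Policy μ X₀ C A) (hσ : σ.IsMWM)
    (π : Policy μ X₀ C A) (t : ℕ) : expectedOccupancy μ σ.X t ≤ expectedOccupancy μ π.X t :=
  lintegral_X_le_of_isMWM hsys σ hσ π t (h := fun x => ((∑ n, x n : ℕ) : ℝ≥0∞))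
    fun _ _ h => Nat.cast_le.mpr h.sum_le

end Domination

end MQMS

theorem theorem2 {Ω : Type*} [MeasurableSpace Ω] (μ : MeasureTheory.Measure Ω)
    [MeasureTheory.IsProbabilityMeasure μ] (N K : ℕ) (p lam : unitInterval)
    (X₀ : Ω → Fin N → ℕ) (C : ℕ → Ω → Fin N → Fin K → ℕ) (A : ℕ → Ω → Fin N → ℕ)
    (hsys : MQMS.IsInput μ p lam X₀ C A)
    (σ : MQMS.Policy μ X₀ C A) (hσ : σ.IsMWM) (π : MQMS.Policy μ X₀ C A) :
    MQMS.Dominates μ σ.X π.X ∧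
    (∀ t, MQMS.expectedOccupancy μ σ.X t ≤ MQMS.expectedOccupancy μ π.X t) ∧
    (∀ T, MQMS.averageDelay μ X₀ A σ.X T ≤ MQMS.averageDelay μ X₀ A π.X T) := by
  have hocc := MQMS.expectedOccupancy_le_of_isMWM hsys σ hσ π
  -- Both delays have the same denominator, which does not depend on the policy.
  exact ⟨MQMS.dominates_of_isMWM hsys σ hσ π, hocc, fun T =>
    ENNReal.div_le_div_right (Finset.sum_le_sum fun t _ => hocc t) _⟩
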